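/- **Theorem.** Let $\sim$ be an adjacency relation on a set of databases and let $\vec q=(q_1,q_2,\dots)$ be a finite or infinite list of real-valued queries, each of global sensitivity at most $1$, i.e. $|q_i(D)-q_i(D')|\le 1$ whenever $D\sim D'$. Let $\epsilon>0$, $\theta\in(0,1)$, $T\in\mathbb R$, let $k\ge 1$ be an integer, and put $$\epsilon_0=\theta\epsilon,\qquad \epsilon_1=\frac{(1-\theta)\epsilon}{k},\qquad \epsilon_2=\frac{\epsilon_1}{2}.$$ *Adaptive SVT* with noise laws $F_0$ (threshold), $F_1$ (middle branch), $F_2$ (top branch) and real constants $b_0,b_1,b_2,\sigma$ is the following algorithm. Draw $\eta\sim F_0$, $\xi_i\sim F_2$ and $\eta_i\sim F_1$ for all $i$, all independent. Set $\widetilde T=T+\eta-b_0$ and $\mathtt{cost}=\epsilon_0$. For $i=1,2,\dots$, as long as the list of queries is not exhausted, let $\tilde q_i=q_i(D)+\xi_i-b_2$ and $\hat q_i=q_i(D)+\eta_i-b_1$, and * if $\tilde q_i-\widetilde T\ge 2\sigma$, output $(\top,\tilde q_i-\widetilde T,\epsilon_2)$ and add $\epsilon_2$ to $\mathtt{cost}$;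 * else if $\hat q_i-\widetilde T\ge 0$, output $(\top,\hat q_i-\widetilde T,\epsilon_1)$ and add $\epsilon_1$ to $\mathtt{cost}$; * else output $(\bot,0)$; then stop if $\mathtt{cost}>\epsilon-\epsilon_1$. The output of the algorithm is the finite or infinite sequence of all these answers. Let $\mathrm{Lap}(\beta)$ have density $\frac1{2\beta}e^{-|x|/\beta}$ on $\mathbb R$, let $\mathrm{Exp}(\beta)$ have density $\frac1\beta e^{-x/\beta}$ on $[0,\infty)$, and let $\mathrm{Geo}(p)$ have mass $p(1-p)^n$ at $n\in\{0,1,2,\dots\}$. A mechanism $M$ is $\epsilon$-differentially private if $\Pr[M(D)\in E]\le e^{\epsilon}\Pr[M(D')\in E]$ for all $D\sim D'$ and all measurable sets $E$ of outputs. The list $\vec q$ is monotonic if for all $D\sim D'$ either $q_i(D)\le q_i(D')$ for all $i$, or $q_i(D)\ge q_i(D')$ for all $i$. Adaptive SVT is $\epsilon$-differentially private in each of the following cases. 1. *Laplace noise:* $F_0=\mathrm{Lap}(1/\epsilon_0)$, $F_1=\mathrm{Lap}(2/\epsilon_1)$, $F_2=\mathrm{Lap}(2/\epsilon_2)$, $b_0=b_1=b_2=0$,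 $\sigma=2\sqrt2/\epsilon_2$. 2. *Exponential noise:* $F_0=\mathrm{Exp}(1/\epsilon_0)$, $F_1=\mathrm{Exp}(2/\epsilon_1)$, $F_2=\mathrm{Exp}(2/\epsilon_2)$, $b_0=1/\epsilon_0$, $b_1=2/\epsilon_1$, $b_2=2/\epsilon_2$, $\sigma=2/\epsilon_2$. 3. *Geometric noise, if all queries are integer-valued:* $F_0=\mathrm{Geo}(1-e^{-\epsilon_0})$, $F_1=\mathrm{Geo}(1-e^{-\epsilon_1/2})$, $F_2=\mathrm{Geo}(1-e^{-\epsilon_2/2})$, $b_0=\frac1{1-e^{-\epsilon_0}}$, $b_1=\frac1{1-e^{-\epsilon_1/2}}$, $b_2=\frac1{1-e^{-\epsilon_2/2}}$, $\sigma=\frac{e^{\epsilon_2/4}}{e^{\epsilon_2/2}-1}$. 4. *Reduced Laplace noise, if $\vec q$ is monotonic:* $F_0=\mathrm{Lap}(1/\epsilon_0)$, $F_1=\mathrm{Lap}(1/\epsilon_1)$, $F_2=\mathrm{Lap}(1/\epsilon_2)$, $b_0=b_1=b_2=0$, with any $\sigma\in\mathbb R$. 5. *Reduced exponential noise, if $\vec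 q$ is monotonic:* $F_0=\mathrm{Exp}(1/\epsilon_0)$, $F_1=\mathrm{Exp}(1/\epsilon_1)$, $F_2=\mathrm{Exp}(1/\epsilon_2)$, $b_0=1/\epsilon_0$, $b_1=1/\epsilon_1$, $b_2=1/\epsilon_2$, $\sigma=1/\epsilon_2$. 6. *Reduced geometric noise, if $\vec q$ is monotonic and all queries are integer-valued:* $F_0=\mathrm{Geo}(1-e^{-\epsilon_0})$, $F_1=\mathrm{Geo}(1-e^{-\epsilon_1})$, $F_2=\mathrm{Geo}(1-e^{-\epsilon_2})$, $b_0=\frac1{1-e^{-\epsilon_0}}$, $b_1=\frac1{1-e^{-\epsilon_1}}$, $b_2=\frac1{1-e^{-\epsilon_2}}$, $\sigma=\frac{e^{\epsilon_2/2}}{e^{\epsilon_2}-1}$. -/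

import Mathlib

open MeasureTheory ProbabilityTheory
open scoped ENNReal

namespace AdaptiveSVT

/-! ### Differential privacy and queries -/

/-- Pure `ε`-differential privacy of a mechanism `M` that maps a database and a noise vector
(distributed according to `μ`) to an output. -/
def IsDifferentiallyPrivate {𝒟 N Ω : Type*} [MeasurableSpace N] [MeasurableSpace Ω]
    (Adj : 𝒟 → 𝒟 → Prop) (μ : Measure N) (M : 𝒟 → N → Ω) (ε : ℝ) : Prop :=
  ∀ D D' : 𝒟, Adj D D' → ∀ E : Set Ω, MeasurableSet E →
    μ {H | M D H ∈ E} ≤ ENNReal.ofReal (Real.exp ε) * μ {H | M D' H ∈ E}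

/-- The global sensitivity of a real-valued query, as an extended nonnegative real. -/
noncomputable def globalSensitivity {𝒟 : Type*} (Adj : 𝒟 → 𝒟 → Prop) (q : 𝒟 → ℝ) : ℝ≥0∞ :=
  ⨆ (D : 𝒟) (D' : 𝒟) (_ : Adj D D'), ENNReal.ofReal |q D - q D'|

/-- A finite or infinite list of real-valued queries. The entries `query i` with `len ≤ i` are
not part of the list. Indices start from `0`. -/
structure QueryList (𝒟 : Type*) where
  len : ℕ∞
  query : ℕ → 𝒟 → ℝ

namespace QueryList

variable {𝒟 : Type*}

/-- Every query of the list has global sensitivity (at most) one. -/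
def SensitivityOne (Adj : 𝒟 → 𝒟 → Prop) (q : QueryList 𝒟) : Prop :=
  ∀ i : ℕ, (i : ℕ∞) < q.len → globalSensitivity Adj (q.query i) ≤ 1

/-- Monotonicity of a list of queries. -/
def Monotonic (Adj : 𝒟 → 𝒟 → Prop) (q : QueryList 𝒟) : Prop :=
  ∀ D D' : 𝒟, Adj D D' →
    (∀ i : ℕ, (i : ℕ∞) < q.len → q.query i D ≤ q.query i D') ∨
    (∀ i : ℕ, (i : ℕ∞) < q.len → q.query i D' ≤ q.query i D)

/-- Every query of the list takes integer values. -/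
def IntegerValued (q : QueryList 𝒟) : Prop :=
  ∀ i : ℕ, (i : ℕ∞) < q.len → ∀ D : 𝒟, ∃ z : ℤ, q.query i D = z

end QueryList

/-! ### Noise distributions -/

/-- `Lap(β)`, with density `(1 / (2β)) exp(-|x| / β)`. -/
noncomputable def lapNoise (β : ℝ) : Measure ℝ :=
  volume.withDensity fun x => ENNReal.ofReal (1 / (2 * β) * Real.exp (-|x| / β))

/-- `Exp(β)`, with mean `β`, that is, with rate `1 / β`. -/
noncomputable def expNoise (β : ℝ) : Measure ℝ :=
  expMeasure (1 / β)

/-- `Geo(p)` for `0 ≤ p ≤ 1` (other values of `p` are clamped to this interval): the law on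
`{0, 1, 2, …} ⊆ ℝ` with mass `p (1 - p) ^ n` at `n`. -/
noncomputable def geoNoise (p : ℝ) : Measure ℝ :=
  (geometricMeasure (Set.projIcc 0 1 zero_le_one p)).map fun n : ℕ => (n : ℝ)

theorem isProbabilityMeasure_lapNoise {β : ℝ} (hβ : 0 < β) :
    IsProbabilityMeasure (lapNoise β) := by
  have h1 : ∀ x : ℝ, -|x| / β = -β⁻¹ * |x| := fun x => by ring
  have hval : ∫ x : ℝ, Real.exp (-β⁻¹ * |x|) = 2 * β := by
    rw [integral_comp_abs (f := fun x => Real.exp (-β⁻¹ * x)),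
      integral_exp_mul_Ioi (by simpa using hβ)]
    simp
  have hint : Integrable (fun x : ℝ => Real.exp (-β⁻¹ * |x|)) :=
    not_imp_comm.1 integral_undef (by rw [hval]; positivity)
  constructor
  rw [lapNoise, withDensity_apply _ MeasurableSet.univ, Measure.restrict_univ]
  simp only [h1]
  rw [← ofReal_integral_eq_lintegral_ofReal (hint.const_mul _)
    (Filter.Eventually.of_forall fun x => by positivity), integral_const_mul, hval]
  rw [one_div_mul_cancel (by positivity), ENNReal.ofReal_one]

theorem isProbabilityMeasure_expNoise {β : ℝ} (hβ : 0 < β) :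
    IsProbabilityMeasure (expNoise β) :=
  isProbabilityMeasure_expMeasure (one_div_pos.mpr hβ)

theorem isProbabilityMeasure_geoNoise (p : ℝ) : IsProbabilityMeasure (geoNoise p) :=
  Measure.isProbabilityMeasure_map Measurable.of_discrete.aemeasurable

/-! ### Outputs -/

/-- The content of one position of the output sequence: `top gap budUsed` stands for the output
`(⊤, gap, bud_used)`, `bot budUsed` for the output `(⊥, bud_used)`, and `halted` means that nothing
is output at this position because the algorithm has stopped before. -/
inductive Slot where
  | top (gap budUsed : ℝ) : Slot
  | bot (budUsed : ℝ) : Slot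
  | halted : Slot

namespace Slot

/-- The slots as a disjoint union of `ℝ × ℝ`, `ℝ` and a point. -/
def toSum : Slot → (ℝ × ℝ) ⊕ (ℝ ⊕ Unit)
  | top gap budUsed => Sum.inl (gap, budUsed)
  | bot budUsed => Sum.inr (Sum.inl budUsed)
  | halted => Sum.inr (Sum.inr ())

instance : MeasurableSpace Slot := MeasurableSpace.comap toSum inferInstance

/-- The privacy budget reported in a slot. -/
def budUsed : Slot → ℝ
  | top _ b => b
  | bot b => b
  | halted => 0

end Slot

/-- The output of the algorithm, a finite or infinite sequence of answers: a finite sequence is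
followed by `Slot.halted` forever. The σ-algebra is the product one. -/
abbrev Output : Type := ℕ → Slot

/-! ### The algorithm -/

/-- The threshold budget `ε₀ = θ ε`. -/
noncomputable def eps0 (ε θ : ℝ) : ℝ := θ * ε

/-- The baseline budget per query, `ε₁ = (1 - θ) ε / k`. -/
noncomputable def eps1 (ε θ : ℝ) (k : ℕ) : ℝ := (1 - θ) * ε / k

/-- The smaller budget per query, `ε₂ = ε₁ / 2`. -/
noncomputable def eps2 (ε θ : ℝ) (k : ℕ) : ℝ := eps1 ε θ k / 2

/-- The noise-dependent ingredients of the algorithm: the laws of the threshold noise `η`, of the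
top branch noises `ξ i` and of the middle branch noises `η i`, the constants `b₀`, `b₁`, `b₂`
subtracted from the noisy threshold, from the middle and from the top noisy query answers, and the
parameter `σ` of the top branch. -/
structure NoiseParams where
  thresholdLaw : Measure ℝ
  topLaw : Measure ℝ
  midLaw : Measure ℝ
  b₀ : ℝ
  b₁ : ℝ
  b₂ : ℝ
  σ : ℝ

/-- A noise vector `(η, ξ, η')`: the threshold noise `η`, the noises `ξ i` of the top branch and
the noises `η' i` of the middle branch. -/
abbrev Noise : Type := ℝ × (ℕ → ℝ) × (ℕ → ℝ)

/-- The law of the noise vector: all the coordinates are independent. -/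
noncomputable def noiseLaw (P : NoiseParams) : Measure Noise :=
  P.thresholdLaw.prod
    ((Measure.infinitePi fun _ : ℕ => P.topLaw).prod (Measure.infinitePi fun _ : ℕ => P.midLaw))

section Algorithm

variable {𝒟 : Type*} (P : NoiseParams) (ε θ : ℝ) (k : ℕ) (T : ℝ) (q : QueryList 𝒟)

/-- The noisy threshold. -/
noncomputable def noisyThreshold (H : Noise) : ℝ := T + H.1 - P.b₀

/-- The noisy query answer of the top branch. -/
noncomputable def topAnswer (D : 𝒟) (H : Noise) (i : ℕ) : ℝ := q.query i D + H.2.1 i - P.b₂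

/-- The noisy query answer of the middle branch. -/
noncomputable def midAnswer (D : 𝒟) (H : Noise) (i : ℕ) : ℝ := q.query i D + H.2.2 i - P.b₁

open Classical in
/-- What the body of the loop outputs for query `i`, if it is executed. -/
noncomputable def answer (D : 𝒟) (H : Noise) (i : ℕ) : Slot :=
  if topAnswer P q D H i - noisyThreshold P T H ≥ 2 * P.σ then
    Slot.top (topAnswer P q D H i - noisyThreshold P T H) (eps2 ε θ k)
  else if midAnswer P q D H i - noisyThreshold P T H ≥ 0 then
    Slot.top (midAnswer P q D H i - noisyThreshold P T H) (eps1 ε θ k)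
  else
    Slot.bot 0

/-- The value of the variable `cost` after `n` executions of the body of the loop. -/
noncomputable def cost (D : 𝒟) (H : Noise) : ℕ → ℝ
  | 0 => eps0 ε θ
  | n + 1 => cost D H n + (answer P ε θ k T q D H n).budUsed

/-- The body of the loop is executed for query `i`: the list has such a query, and the test
`cost > ε - ε₁` at the end of the body has not led to a break for an earlier query. -/
def Reached (D : 𝒟) (H : Noise) (i : ℕ) : Prop :=
  (i : ℕ∞) < q.len ∧ ∀ j < i, ¬ (cost P ε θ k T q D H (j + 1) > ε - eps1 ε θ k)

open Classical in
/-- Adaptive SVT, run on the database `D` with the noise vector `H`. -/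
noncomputable def adaptiveSVT (D : 𝒟) (H : Noise) : Output := fun i =>
  if Reached P ε θ k T q D H i then answer P ε θ k T q D H i else Slot.halted

/-- Adaptive SVT with the noise parameters `P` satisfies `ε`-differential privacy. -/
def IsPrivate (Adj : 𝒟 → 𝒟 → Prop) : Prop :=
  IsDifferentiallyPrivate Adj (noiseLaw P) (adaptiveSVT P ε θ k T q) ε

end Algorithm

/-! ### The choices of the noise -/

/-- Laplace noise. -/
noncomputable def laplace (ε θ : ℝ) (k : ℕ) : NoiseParams where
  thresholdLaw := lapNoise (1 / eps0 ε θ)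
  topLaw := lapNoise (2 / eps2 ε θ k)
  midLaw := lapNoise (2 / eps1 ε θ k)
  b₀ := 0
  b₁ := 0
  b₂ := 0
  σ := 2 * √2 / eps2 ε θ k

/-- Reduced Laplace noise, with any value `σ` for the parameter of the top branch. -/
noncomputable def laplaceReduced (ε θ : ℝ) (k : ℕ) (σ : ℝ) : NoiseParams where
  thresholdLaw := lapNoise (1 / eps0 ε θ)
  topLaw := lapNoise (1 / eps2 ε θ k)
  midLaw := lapNoise (1 / eps1 ε θ k)
  b₀ := 0
  b₁ := 0
  b₂ := 0
  σ := σ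

/-- Exponential noise. -/
noncomputable def exponential (ε θ : ℝ) (k : ℕ) : NoiseParams where
  thresholdLaw := expNoise (1 / eps0 ε θ)
  topLaw := expNoise (2 / eps2 ε θ k)
  midLaw := expNoise (2 / eps1 ε θ k)
  b₀ := 1 / eps0 ε θ
  b₁ := 2 / eps1 ε θ k
  b₂ := 2 / eps2 ε θ k
  σ := 2 / eps2 ε θ k

/-- Reduced exponential noise. -/
noncomputable def exponentialReduced (ε θ : ℝ) (k : ℕ) : NoiseParams where
  thresholdLaw := expNoise (1 / eps0 ε θ)
  topLaw := expNoise (1 / eps2 ε θ k)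
  midLaw := expNoise (1 / eps1 ε θ k)
  b₀ := 1 / eps0 ε θ
  b₁ := 1 / eps1 ε θ k
  b₂ := 1 / eps2 ε θ k
  σ := 1 / eps2 ε θ k

/-- Geometric noise. -/
noncomputable def geometric (ε θ : ℝ) (k : ℕ) : NoiseParams where
  thresholdLaw := geoNoise (1 - Real.exp (-eps0 ε θ))
  topLaw := geoNoise (1 - Real.exp (-eps2 ε θ k / 2))
  midLaw := geoNoise (1 - Real.exp (-eps1 ε θ k / 2))
  b₀ := 1 / (1 - Real.exp (-eps0 ε θ))
  b₁ := 1 / (1 - Real.exp (-eps1 ε θ k / 2))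
  b₂ := 1 / (1 - Real.exp (-eps2 ε θ k / 2))
  σ := Real.exp (eps2 ε θ k / 4) / (Real.exp (eps2 ε θ k / 2) - 1)

/-- Reduced geometric noise. -/
noncomputable def geometricReduced (ε θ : ℝ) (k : ℕ) : NoiseParams where
  thresholdLaw := geoNoise (1 - Real.exp (-eps0 ε θ))
  topLaw := geoNoise (1 - Real.exp (-eps2 ε θ k))
  midLaw := geoNoise (1 - Real.exp (-eps1 ε θ k))
  b₀ := 1 / (1 - Real.exp (-eps0 ε θ))
  b₁ := 1 / (1 - Real.exp (-eps1 ε θ k))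
  b₂ := 1 / (1 - Real.exp (-eps2 ε θ k))
  σ := Real.exp (eps2 ε θ k / 2) / (Real.exp (eps2 ε θ k) - 1)

end AdaptiveSVT

namespace AdaptiveSVT

/-! ### Products of dominated measures -/

/-! The argument is a randomness alignment. For adjacent `D`, `D'`, a run on `D` is matched with a
run on `D'` whose threshold noise is shifted by a constant `a` and whose noise is shifted by `a + qᵢ
D - qᵢ D'` in the branch that produced each answer `⊤`; all other noises are kept. The gaps at
answers `⊤` are then unchanged. If these shifts are nonnegative, every failed test sees its left
side decrease, so it still fails and the whole output is the same (`adaptiveSVT_alignNoise`). The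
constants `b₀`, `b₁`, `b₂` and `σ` are common to both runs, so privacy puts no condition on them.

The shift depends on the noise only through the sets `S` and `R` of positions answered by the top
and by the middle branch. The stopping rule keeps the spent budget at most `ε`, so both sets are
finite and there are countably many patterns `(S, R)`. On each pattern the alignment is a fixed
translation of finitely many coordinates, and it multiplies the law by at most `exp (eps0 + |S| eps2
+ |R| eps1) ≤ exp ε` (`map_alignNoise_le`, `HasPattern.budget_le`). Summing over the disjoint
patterns gives privacy (`measure_adaptiveSVT_le`).

It remains to bound translates of each noise law. With `a = 1` the query shifts lie in `[0, 2]`. For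
monotonic lists, `a = 1` or `a = 0`, according to the direction, keeps them in `[0, 1]`, which
permits half the noise scale. -/

theorem measurable_update_swap {ι : Type*} [DecidableEq ι] {X : ι → Type*}
    [∀ i, MeasurableSpace (X i)] (a : ι) :
    Measurable fun p : X a × (∀ i, X i) => Function.update p.2 a p.1 := by
  refine measurable_pi_iff.mpr fun i => ?_
  by_cases hi : i = a
  · subst hi
    simpa using measurable_fst
  · simp only [Function.update_of_ne hi]
    exact (measurable_pi_apply i).comp measurable_snd

/-- Changing one factor of an infinite product of probability measures amounts to resampling that
coordinate. -/
theorem infinitePi_eq_map_update {ι : Type*} [DecidableEq ι] {X : ι → Type*}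
    [∀ i, MeasurableSpace (X i)] (μ ν : ∀ i, Measure (X i)) [∀ i, IsProbabilityMeasure (μ i)]
    [∀ i, IsProbabilityMeasure (ν i)] (a : ι) (h : ∀ i, i ≠ a → ν i = μ i) :
    Measure.infinitePi ν =
      ((ν a).prod (Measure.infinitePi μ)).map fun p => Function.update p.2 a p.1 := by
  have hmeas := measurable_update_swap (X := X) a
  -- It suffices to compare boxes over a finite `s`: the resampled coordinate contributes `ν a (t
  -- a)` if `a ∈ s`, and total mass one otherwise.
  refine (Measure.eq_infinitePi ν fun s t ht => ?_).symm
  rw [Measure.map_apply hmeas (MeasurableSet.pi s.countable_toSet fun i _ => ht i)]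
  by_cases ha : a ∈ s
  · have hpre : (fun p : X a × (∀ i, X i) => Function.update p.2 a p.1) ⁻¹' Set.pi s t =
        t a ×ˢ Set.pi (s.erase a) t := by
      ext p
      simp only [Set.mem_preimage, Set.mem_pi, Set.mem_prod, Finset.mem_coe, Finset.mem_erase]
      constructor
      · intro hp
        refine ⟨by simpa using hp a ha, fun i hi => ?_⟩
        simpa [Function.update_of_ne hi.1] using hp i hi.2
      · rintro ⟨h1, h2⟩ i hi
        by_cases hia : i = a
        · subst hia
          simpa using h1
        · simpa [Function.update_of_ne hia] using h2 i ⟨hia, hi⟩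
    rw [hpre, Measure.prod_prod, Measure.infinitePi_pi _ fun i _ => ht i,
      ← Finset.mul_prod_erase s _ ha]
    congr 1
    exact Finset.prod_congr rfl fun i hi => by rw [h i (Finset.ne_of_mem_erase hi)]
  · have hpre : (fun p : X a × (∀ i, X i) => Function.update p.2 a p.1) ⁻¹' Set.pi s t =
        Set.univ ×ˢ Set.pi s t := by
      ext p
      simp only [Set.mem_preimage, Set.mem_pi, Set.mem_prod, Finset.mem_coe, Set.mem_univ,
        true_and]
      refine forall₂_congr fun i hi => ?_
      rw [Function.update_of_ne (ne_of_mem_of_not_mem hi ha)]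
    rw [hpre, Measure.prod_prod, Measure.infinitePi_pi _ fun i _ => ht i, measure_univ, one_mul]
    exact Finset.prod_congr rfl fun i hi => by rw [h i (ne_of_mem_of_not_mem hi ha)]

/-- If finitely many factors are changed to measures dominated by multiples of the old ones, the
infinite product is dominated by the corresponding multiple. -/
theorem infinitePi_le_smul {ι : Type*} {X : ι → Type*}
    [∀ i, MeasurableSpace (X i)] (μ ν : ∀ i, Measure (X i)) [∀ i, IsProbabilityMeasure (μ i)]
    [hν : ∀ i, IsProbabilityMeasure (ν i)] (c : ℝ≥0∞) (S : Finset ι)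
    (hS : ∀ i ∈ S, ν i ≤ c • μ i) (hS' : ∀ i ∉ S, ν i = μ i) :
    Measure.infinitePi ν ≤ c ^ S.card • Measure.infinitePi μ := by
  classical
  induction S using Finset.induction_on generalizing ν with
  | empty =>
    obtain rfl : ν = μ := funext fun i => hS' i (by simp)
    simp
  | insert a S ha ih =>
    have hprob : ∀ i, IsProbabilityMeasure (Function.update ν a (μ a) i) := fun i => by
      by_cases hi : i = a
      · subst hi
        simpa using ‹∀ i, IsProbabilityMeasure (μ i)› i
      · simpa [Function.update_of_ne hi] using hν i
    -- Undoing the change at `a` leaves a family that differs from `μ` only on `S`; redoing it then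
    -- costs a single factor `c`.
    have h1 : Measure.infinitePi (Function.update ν a (μ a)) ≤
        c ^ S.card • Measure.infinitePi μ := by
      refine ih _ (fun i hi => ?_) fun i hi => ?_
      · rw [Function.update_of_ne (ne_of_mem_of_not_mem hi ha)]
        exact hS i (Finset.mem_insert_of_mem hi)
      · by_cases hia : i = a
        · subst hia
          simp
        · rw [Function.update_of_ne hia]
          exact hS' i (by simp [hia, hi])
    have h2 : Measure.infinitePi ν ≤ c • Measure.infinitePi (Function.update ν a (μ a)) := by
      calc Measure.infinitePi ν
          = ((ν a).prod (Measure.infinitePi (Function.update ν a (μ a)))).map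
              fun p => Function.update p.2 a p.1 :=
            infinitePi_eq_map_update _ ν a fun i hi => (Function.update_of_ne hi _ _).symm
        _ ≤ ((c • Function.update ν a (μ a) a).prod
              (Measure.infinitePi (Function.update ν a (μ a)))).map
              fun p => Function.update p.2 a p.1 := by
            refine Measure.map_mono (Measure.prod_mono ?_ le_rfl) (measurable_update_swap a)
            simpa using hS a (Finset.mem_insert_self a S)
        _ = c • Measure.infinitePi (Function.update ν a (μ a)) := by
            rw [Measure.prod_smul_left, Measure.map_smul,
              ← infinitePi_eq_map_update _ _ a fun _ _ => rfl]
    rw [Finset.card_insert_of_notMem ha, pow_succ', mul_smul]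
    refine h2.trans fun A => ?_
    simpa using mul_le_mul_right (h1 A) c

/-- Translating finitely many coordinates of an infinite power of a measure. -/
theorem map_add_infinitePi_le {ι : Type*} (μ : Measure ℝ) [IsProbabilityMeasure μ] (c : ℝ≥0∞)
    (S : Finset ι) (v : ι → ℝ) (hS : ∀ i ∈ S, μ.map (· + v i) ≤ c • μ)
    (hS' : ∀ i ∉ S, v i = 0) :
    (Measure.infinitePi fun _ : ι => μ).map (· + v) ≤
      c ^ S.card • Measure.infinitePi fun _ : ι => μ := by
  have hm : ∀ i, Measurable (fun x : ℝ => x + v i) := fun i => measurable_add_const _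
  have hprob : ∀ i, IsProbabilityMeasure (μ.map (· + v i)) := fun i =>
    Measure.isProbabilityMeasure_map (hm i).aemeasurable
  have h : (Measure.infinitePi fun _ : ι => μ).map (· + v) =
      Measure.infinitePi fun i => μ.map (· + v i) := by
    rw [← Measure.infinitePi_map_pi (fun _ : ι => μ) hm]
    rfl
  rw [h]
  exact infinitePi_le_smul _ _ c S hS fun i hi => by simp [hS' i hi]

/-! ### Translates of the noise distributions -/

/-- The translate of a measure with a density on the line. -/
theorem map_add_withDensity_le (f : ℝ → ℝ≥0∞) (hf : Measurable f) (v : ℝ) (c : ℝ≥0∞)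
    (h : ∀ x, f x ≤ c * f (x + v)) :
    (volume.withDensity f).map (· + v) ≤ c • volume.withDensity f := by
  refine Measure.le_iff.mpr fun s hs => ?_
  have hv : Measurable fun x : ℝ => x + v := measurable_add_const v
  rw [Measure.map_apply hv hs, withDensity_apply _ (hv hs), Measure.smul_apply, smul_eq_mul,
    withDensity_apply _ hs, ← lintegral_const_mul _ hf]
  calc ∫⁻ x in (· + v) ⁻¹' s, f x ≤ ∫⁻ x in (· + v) ⁻¹' s, c * f (x + v) :=
        lintegral_mono fun x => h x
    _ = ∫⁻ x in s, c * f x := by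
        exact (measurePreserving_add_right volume v).setLIntegral_comp_preimage hs
          (hf.const_mul c)

/-- The triangle inequality bounds the ratio of the densities at `x` and `x + v` by `exp (|v| / β)`.
-/
theorem map_add_lapNoise_le {β v a : ℝ} (hβ : 0 < β) (hv : |v| ≤ a * β) :
    (lapNoise β).map (· + v) ≤ ENNReal.ofReal (Real.exp a) • lapNoise β := by
  refine map_add_withDensity_le _ (by fun_prop) _ _ fun x => ?_
  rw [← ENNReal.ofReal_mul (Real.exp_nonneg _)]
  refine ENNReal.ofReal_le_ofReal ?_
  rw [mul_left_comm, ← Real.exp_add]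
  gcongr
  have h1 : |x + v| ≤ |x| + |v| := abs_add_le x v
  rw [div_le_iff₀ hβ, add_mul, div_mul_cancel₀ _ hβ.ne']
  linarith

/-- On the support the density ratio is exactly `exp (v / β)`. The sign of `v` matters: a shift to
the left would put mass on negative numbers, which the law does not charge. -/
theorem map_add_expNoise_le {β v a : ℝ} (hβ : 0 < β) (hv₀ : 0 ≤ v) (hv : v ≤ a * β) :
    (expNoise β).map (· + v) ≤ ENNReal.ofReal (Real.exp a) • expNoise β := by
  have hdens : expNoise β = volume.withDensity (exponentialPDF (1 / β)) := rfl
  rw [hdens]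
  refine map_add_withDensity_le _ (measurable_exponentialPDFReal _).ennreal_ofReal _ _ fun x => ?_
  change exponentialPDF _ _ ≤ _ * exponentialPDF _ _
  rcases lt_or_ge x 0 with hx | hx
  · simp [exponentialPDF_of_neg hx]
  · rw [exponentialPDF_of_nonneg hx, exponentialPDF_of_nonneg (add_nonneg hx hv₀),
      ← ENNReal.ofReal_mul (Real.exp_nonneg _)]
    refine ENNReal.ofReal_le_ofReal ?_
    rw [mul_left_comm, ← Real.exp_add]
    gcongr
    have : v / β ≤ a := (div_le_iff₀ hβ).mpr hv
    have h2 : 1 / β * (x + v) = 1 / β * x + v / β := by ring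
    linarith

/-- The translate has no mass below `n`, and from `n` on the ratio of the masses is `(1 - p) ^
(-n)`. -/
theorem map_add_geometricMeasure_le {p : unitInterval} (hp₀ : p ≠ 0) {a : ℝ} {n : ℕ}
    (hp : 1 ≤ Real.exp a * (1 - p : ℝ) ^ n) :
    (geometricMeasure p).map (· + n) ≤
      ENNReal.ofReal (Real.exp a) • geometricMeasure p := by
  refine Measure.le_iff.mpr fun s _ => ?_
  rw [← Measure.tsum_indicator_apply_singleton _ s (MeasurableSet.of_discrete),
    ← Measure.tsum_indicator_apply_singleton _ s (MeasurableSet.of_discrete)]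
  refine ENNReal.tsum_le_tsum fun m => ?_
  by_cases hm : m ∈ s
  · simp only [Set.indicator_of_mem hm]
    rw [Measure.map_apply Measurable.of_discrete MeasurableSet.of_discrete, Measure.smul_apply,
      smul_eq_mul]
    by_cases hmn : n ≤ m
    · have hpre : (· + n) ⁻¹' {m} = ({m - n} : Set ℕ) := by
        ext j
        simp only [Set.mem_preimage, Set.mem_singleton_iff]
        omega
      rw [hpre, geometricMeasure_singleton hp₀, geometricMeasure_singleton hp₀,
        ← ENNReal.ofReal_mul (Real.exp_nonneg _)]
      refine ENNReal.ofReal_le_ofReal ?_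
      have h1 := geometricMeasure_nonneg p (m - n)
      obtain ⟨j, rfl⟩ := Nat.exists_eq_add_of_le hmn
      rw [Nat.add_sub_cancel_left] at *
      calc (1 - p : ℝ) ^ j * p ≤ (Real.exp a * (1 - p : ℝ) ^ n) * ((1 - p : ℝ) ^ j * p) :=
            le_mul_of_one_le_left h1 hp
        _ = Real.exp a * ((1 - p : ℝ) ^ (n + j) * p) := by rw [pow_add]; ring
    · have hpre : (· + n) ⁻¹' {m} = (∅ : Set ℕ) := by
        ext j
        simp only [Set.mem_preimage, Set.mem_singleton_iff, Set.mem_empty_iff_false, iff_false]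
        omega
      simp [hpre]
  · simp [Set.indicator_of_notMem hm]

/-- Here `1 - p = exp (-b)`, so each unit of translation costs a factor `exp b`. The shift has to be
an integer because the law is carried by `ℕ`. -/
theorem map_add_geoNoise_le {b v a : ℝ} (hb : 0 < b) (hv : ∃ z : ℤ, v = z) (hv₀ : 0 ≤ v)
    (hva : v * b ≤ a) :
    (geoNoise (1 - Real.exp (-b))).map (· + v) ≤
      ENNReal.ofReal (Real.exp a) • geoNoise (1 - Real.exp (-b)) := by
  obtain ⟨z, rfl⟩ := hv
  obtain ⟨n, rfl⟩ := Int.eq_ofNat_of_zero_le (by exact_mod_cast hv₀ : 0 ≤ z)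
  have he : Real.exp (-b) < 1 := by simpa using hb
  have hmem : 1 - Real.exp (-b) ∈ Set.Icc (0 : ℝ) 1 :=
    ⟨by linarith, by linarith [Real.exp_pos (-b)]⟩
  have hp : ((Set.projIcc 0 1 zero_le_one (1 - Real.exp (-b)) : unitInterval) : ℝ) =
      1 - Real.exp (-b) := by rw [Set.projIcc_of_mem _ hmem]
  have hcast : Measurable fun m : ℕ => (m : ℝ) := Measurable.of_discrete
  have hadd : Measurable fun x : ℝ => x + ((n : ℤ) : ℝ) := measurable_add_const _
  unfold geoNoise
  set p := Set.projIcc 0 1 zero_le_one (1 - Real.exp (-b))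
  have hp₀ : p ≠ 0 := by
    intro h
    have hp' : (0 : ℝ) = 1 - Real.exp (-b) := by rw [← hp, h]; rfl
    linarith
  have hle := Measure.map_mono (map_add_geometricMeasure_le hp₀ (a := a) (n := n) (by
    rw [hp, sub_sub_cancel, ← Real.exp_nat_mul, ← Real.exp_add]
    refine Real.one_le_exp ?_
    push_cast at hva
    linarith)) hcast
  rw [Measure.map_smul, Measure.map_map hcast Measurable.of_discrete] at hle
  rw [Measure.map_map hadd hcast]
  convert hle using 2
  ext m
  simp


/-! ### Measurability of the algorithm -/

namespace Slot

theorem measurable_toSum : Measurable toSum := comap_measurable toSum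

theorem measurable_top (b : ℝ) : Measurable fun g : ℝ => Slot.top g b :=
  measurable_comap_iff.mpr (measurable_inl.comp (measurable_id.prodMk measurable_const))

theorem measurable_budUsed : Measurable budUsed := by
  have h : budUsed = Sum.elim Prod.snd (Sum.elim id fun _ => 0) ∘ toSum := by
    ext s
    cases s <;> rfl
  rw [h]
  exact (measurable_snd.sumElim (measurable_id.sumElim measurable_const)).comp measurable_toSum

/-- The answers `⊤` with reported budget `b`. -/
def topSet (b : ℝ) : Set Slot := {s | ∃ g, s = Slot.top g b}

theorem measurableSet_topSet (b : ℝ) : MeasurableSet (topSet b) := by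
  have h : topSet b = toSum ⁻¹' (Sum.inl '' (Set.univ ×ˢ {b})) := by
    ext s
    cases s <;> simp [topSet, toSum, eq_comm]
  rw [h]
  exact measurable_toSum
    (measurableSet_inl_image.mpr (MeasurableSet.univ.prod (measurableSet_singleton b)))

end Slot

section Algorithm

variable {𝒟 : Type*} (P : NoiseParams) (ε θ : ℝ) (k : ℕ) (T : ℝ) (q : QueryList 𝒟)

theorem measurable_answer (D : 𝒟) (i : ℕ) :
    Measurable fun H : Noise => answer P ε θ k T q D H i := by
  have h0 : Measurable fun H : Noise => noisyThreshold P T H := by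
    unfold noisyThreshold
    fun_prop
  have h1 : Measurable fun H : Noise => topAnswer P q D H i := by
    unfold topAnswer
    fun_prop
  have h2 : Measurable fun H : Noise => midAnswer P q D H i := by
    unfold midAnswer
    fun_prop
  unfold answer
  refine Measurable.ite (measurableSet_le measurable_const (h1.sub h0))
    ((Slot.measurable_top _).comp (h1.sub h0)) ?_
  exact Measurable.ite (measurableSet_le measurable_const (h2.sub h0))
    ((Slot.measurable_top _).comp (h2.sub h0)) measurable_const

theorem measurable_cost (D : 𝒟) (n : ℕ) :
    Measurable fun H : Noise => cost P ε θ k T q D H n := by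
  induction n with
  | zero => exact measurable_const
  | succ n ih => exact ih.add (Slot.measurable_budUsed.comp (measurable_answer P ε θ k T q D n))

theorem measurableSet_reached (D : 𝒟) (i : ℕ) :
    MeasurableSet {H : Noise | Reached P ε θ k T q D H i} := by
  have h : {H : Noise | Reached P ε θ k T q D H i} = {_H : Noise | (i : ℕ∞) < q.len} ∩
      ⋂ j, ⋂ _ : j < i, {H | ε - eps1 ε θ k < cost P ε θ k T q D H (j + 1)}ᶜ := by
    ext H
    simp [Reached]
  rw [h]
  exact (MeasurableSet.const _).inter (MeasurableSet.iInter fun j => MeasurableSet.iInter fun _ =>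
    (measurableSet_lt measurable_const (measurable_cost P ε θ k T q D (j + 1))).compl)

theorem measurable_adaptiveSVT (D : 𝒟) : Measurable (adaptiveSVT P ε θ k T q D) :=
  measurable_pi_iff.mpr fun i =>
    Measurable.ite (measurableSet_reached P ε θ k T q D i) (measurable_answer P ε θ k T q D i)
      measurable_const

/-! ### The privacy budget -/

variable {P ε θ k T q} {D : 𝒟} {H : Noise}

theorem Reached.of_le {i j : ℕ} (h : Reached P ε θ k T q D H i) (hj : j ≤ i) :
    Reached P ε θ k T q D H j :=
  ⟨lt_of_le_of_lt (by exact_mod_cast hj) h.1, fun l hl => h.2 l (hl.trans_le hj)⟩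

theorem adaptiveSVT_of_reached {i : ℕ} (h : Reached P ε θ k T q D H i) :
    adaptiveSVT P ε θ k T q D H i = answer P ε θ k T q D H i := if_pos h

theorem adaptiveSVT_of_not_reached {i : ℕ} (h : ¬ Reached P ε θ k T q D H i) :
    adaptiveSVT P ε θ k T q D H i = Slot.halted := if_neg h

theorem eps1_pos (hε : 0 < ε) (hθ₁ : θ < 1) (hk : 1 ≤ k) : 0 < eps1 ε θ k :=
  div_pos (mul_pos (by linarith) hε) (by exact_mod_cast hk)

theorem eps2_pos (hε : 0 < ε) (hθ₁ : θ < 1) (hk : 1 ≤ k) : 0 < eps2 ε θ k :=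
  half_pos (eps1_pos hε hθ₁ hk)

/-- The first query is preceded by no stopping test; this inequality, a consequence of `k ≥ 1`,
takes the place of that test. -/
theorem eps0_add_eps1_le (hε : 0 < ε) (hθ₁ : θ < 1) (hk : 1 ≤ k) :
    eps0 ε θ + eps1 ε θ k ≤ ε := by
  have h : eps1 ε θ k ≤ (1 - θ) * ε :=
    div_le_self (mul_nonneg (by linarith) hε.le) (by exact_mod_cast hk)
  unfold eps0
  linarith

theorem budUsed_answer_nonneg (h₁ : 0 < eps1 ε θ k) (i : ℕ) :
    0 ≤ (answer P ε θ k T q D H i).budUsed := by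
  unfold answer
  split_ifs <;> simp only [Slot.budUsed, eps2] <;> linarith

theorem budUsed_answer_le (h₁ : 0 < eps1 ε θ k) (i : ℕ) :
    (answer P ε θ k T q D H i).budUsed ≤ eps1 ε θ k := by
  unfold answer
  split_ifs <;> simp only [Slot.budUsed, eps2] <;> linarith

theorem budUsed_adaptiveSVT_nonneg (h₁ : 0 < eps1 ε θ k) (i : ℕ) :
    0 ≤ (adaptiveSVT P ε θ k T q D H i).budUsed := by
  by_cases h : Reached P ε θ k T q D H i
  · rw [adaptiveSVT_of_reached h]
    exact budUsed_answer_nonneg h₁ i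
  · rw [adaptiveSVT_of_not_reached h]
    rfl

/-- `cost` keeps accumulating answers after the algorithm has stopped, whereas halted slots report
zero budget, so the two agree only while the queries are reached. -/
theorem cost_eq_sum_of_reached {n : ℕ} (h : ∀ i < n, Reached P ε θ k T q D H i) :
    cost P ε θ k T q D H n =
      eps0 ε θ + ∑ i ∈ Finset.range n, (adaptiveSVT P ε θ k T q D H i).budUsed := by
  induction n with
  | zero => simp [cost]
  | succ n ih =>
    rw [Finset.sum_range_succ, cost, ih fun i hi => h i (hi.trans n.lt_succ_self),
      adaptiveSVT_of_reached (h n n.lt_succ_self), add_assoc]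

/-- The total budget spent is at most `ε`. -/
theorem sum_budUsed_adaptiveSVT_le (hε : 0 < ε) (hθ₁ : θ < 1) (hk : 1 ≤ k) (n : ℕ) :
    eps0 ε θ + ∑ i ∈ Finset.range n, (adaptiveSVT P ε θ k T q D H i).budUsed ≤ ε := by
  have h₁ := eps1_pos hε hθ₁ hk
  have h₀ := eps0_add_eps1_le hε hθ₁ hk
  induction n with
  | zero => simpa using by linarith
  | succ n ih =>
    rw [Finset.sum_range_succ]
    by_cases h : Reached P ε θ k T q D H n
    -- Query `n` is reached only if the previous test left room for `eps1`, which is the most that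
    -- one answer can spend.
    · have hc : cost P ε θ k T q D H n ≤ ε - eps1 ε θ k := by
        cases n with
        | zero => rw [cost]; linarith
        | succ m => exact not_lt.mp (h.2 m m.lt_succ_self)
      rw [cost_eq_sum_of_reached fun i hi => h.of_le hi.le] at hc
      rw [adaptiveSVT_of_reached h]
      linarith [budUsed_answer_le (P := P) (T := T) (q := q) (D := D) (H := H) h₁ n]
    · rw [adaptiveSVT_of_not_reached h]
      simpa [Slot.budUsed] using ih

/-- The answers `⊤` of reported budget `eps2` are at the positions in `S`, those of reported
budget `eps1` at the positions in `R`. -/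
def HasPattern (ε θ : ℝ) (k : ℕ) (S R : Finset ℕ) (ω : Output) : Prop :=
  ∀ i, (i ∈ S ↔ ω i ∈ Slot.topSet (eps2 ε θ k)) ∧ (i ∈ R ↔ ω i ∈ Slot.topSet (eps1 ε θ k))

theorem HasPattern.unique {S R S' R' : Finset ℕ} {ω : Output} (h : HasPattern ε θ k S R ω)
    (h' : HasPattern ε θ k S' R' ω) : (S, R) = (S', R') :=
  Prod.ext (Finset.ext fun i => (h i).1.trans (h' i).1.symm)
    (Finset.ext fun i => (h i).2.trans (h' i).2.symm)

theorem measurableSet_hasPattern (S R : Finset ℕ) :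
    MeasurableSet {ω | HasPattern ε θ k S R ω} := by
  unfold HasPattern
  rw [Set.ofPred_forall]
  refine MeasurableSet.iInter fun i => MeasurableSet.inter ?_ ?_
  · exact (MeasurableSet.const (i ∈ S)).iff
      (measurable_pi_apply i (Slot.measurableSet_topSet (eps2 ε θ k)))
  · exact (MeasurableSet.const (i ∈ R)).iff
      (measurable_pi_apply i (Slot.measurableSet_topSet (eps1 ε θ k)))

/-- The reported budgets are nonnegative with bounded partial sums, hence tend to zero, while each
answer `⊤` spends at least `eps2 > 0`. So even an infinite output has finitely many of them, for
every noise vector and not just almost surely. -/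
theorem exists_hasPattern (hε : 0 < ε) (hθ₁ : θ < 1) (hk : 1 ≤ k) :
    ∃ S R : Finset ℕ, HasPattern ε θ k S R (adaptiveSVT P ε θ k T q D H) := by
  have h₁ := eps1_pos hε hθ₁ hk
  have h₂ := eps2_pos hε hθ₁ hk
  have hsum : Summable fun i => (adaptiveSVT P ε θ k T q D H i).budUsed :=
    summable_of_sum_range_le (c := ε - eps0 ε θ) (budUsed_adaptiveSVT_nonneg h₁) fun n => by
      linarith [sum_budUsed_adaptiveSVT_le (P := P) (T := T) (q := q) (D := D) (H := H)
        hε hθ₁ hk n]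
  have hfin : {i | ¬ (adaptiveSVT P ε θ k T q D H i).budUsed < eps2 ε θ k}.Finite :=
    Filter.eventually_cofinite.mp (hsum.tendsto_cofinite_zero.eventually_lt_const h₂)
  have hfin' : ∀ b, eps2 ε θ k ≤ b →
      {i | adaptiveSVT P ε θ k T q D H i ∈ Slot.topSet b}.Finite := fun b hb =>
    hfin.subset fun i ⟨g, hg⟩ => by
      simpa only [Set.mem_ofPred_eq, hg, Slot.budUsed, not_lt] using hb
  refine ⟨(hfin' _ le_rfl).toFinset, (hfin' (eps1 ε θ k) ?_).toFinset, fun i => ?_⟩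
  · unfold eps2
    linarith
  · simp

/-- The budget of the threshold and of the answers `⊤` is at most `ε`. -/
theorem HasPattern.budget_le (hε : 0 < ε) (hθ₁ : θ < 1) (hk : 1 ≤ k) {S R : Finset ℕ}
    (h : HasPattern ε θ k S R (adaptiveSVT P ε θ k T q D H)) :
    eps0 ε θ + (S.card * eps2 ε θ k + R.card * eps1 ε θ k) ≤ ε := by
  classical
  have h₁ := eps1_pos hε hθ₁ hk
  set b := fun i => (adaptiveSVT P ε θ k T q D H i).budUsed with hb
  have hS : ∀ i ∈ S, b i = eps2 ε θ k := fun i hi => by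
    obtain ⟨g, hg⟩ := (h i).1.mp hi
    simp [hb, hg, Slot.budUsed]
  have hR : ∀ i ∈ R, b i = eps1 ε θ k := fun i hi => by
    obtain ⟨g, hg⟩ := (h i).2.mp hi
    simp [hb, hg, Slot.budUsed]
  have hdisj : Disjoint S R := Finset.disjoint_left.mpr fun i hi hi' => by
    have := (hS i hi).symm.trans (hR i hi')
    unfold eps2 at this
    linarith
  -- An initial segment containing all answers `⊤`, so that the bound on partial sums applies.
  have hsub : S ∪ R ⊆ Finset.range ((S ∪ R).sup id + 1) := fun i hi =>
    Finset.mem_range_succ_iff.mpr (Finset.le_sup (f := id) hi)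
  have hle : ∑ i ∈ S ∪ R, b i ≤ ∑ i ∈ Finset.range ((S ∪ R).sup id + 1), b i :=
    Finset.sum_le_sum_of_subset_of_nonneg hsub fun i _ _ => budUsed_adaptiveSVT_nonneg h₁ i
  rw [Finset.sum_union hdisj, Finset.sum_congr rfl hS, Finset.sum_congr rfl hR,
    Finset.sum_const, Finset.sum_const, nsmul_eq_mul, nsmul_eq_mul] at hle
  linarith [sum_budUsed_adaptiveSVT_le (P := P) (T := T) (q := q) (D := D) (H := H)
        hε hθ₁ hk ((S ∪ R).sup id + 1)]

/-! ### Randomness alignment -/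

/-- The restriction of a sequence to a finite set, continued by zero. -/
def restrictTo (S : Finset ℕ) (v : ℕ → ℝ) : ℕ → ℝ := fun i => if i ∈ S then v i else 0

/-- The translation of the noise vector by `a` at the threshold, by `v` at the positions in `S` of
the top branch, and by `v` at the positions in `R` of the middle branch. -/
def alignNoise (a : ℝ) (v : ℕ → ℝ) (S R : Finset ℕ) : Noise → Noise :=
  Prod.map (· + a) (Prod.map (· + restrictTo S v) (· + restrictTo R v))

/-- If `S` and `R` are the positions of the answers `⊤`, then the algorithm run on an adjacent
database with the translated noise has the same output. -/
theorem adaptiveSVT_alignNoise (h₁ : 0 < eps1 ε θ k) {D' : 𝒟} {a : ℝ} {S R : Finset ℕ}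
    (h : HasPattern ε θ k S R (adaptiveSVT P ε θ k T q D H))
    (hv : ∀ i : ℕ, (i : ℕ∞) < q.len → 0 ≤ a + q.query i D - q.query i D') :
    adaptiveSVT P ε θ k T q D'
      (alignNoise a (fun i => a + q.query i D - q.query i D') S R H) =
      adaptiveSVT P ε θ k T q D H := by
  set H' := alignNoise a (fun i => a + q.query i D - q.query i D') S R H with hH'
  have h₂ : eps2 ε θ k ≠ eps1 ε θ k := by
    unfold eps2
    linarith
  have hthr : noisyThreshold P T H' = noisyThreshold P T H + a := by
    simp only [noisyThreshold, hH', alignNoise, Prod.map_fst]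
    ring
  have htop : ∀ i, topAnswer P q D' H' i = topAnswer P q D H i + (q.query i D' - q.query i D) +
      restrictTo S (fun i => a + q.query i D - q.query i D') i := fun i => by
    simp only [topAnswer, hH', alignNoise, Prod.map_fst, Prod.map_snd, Pi.add_apply]
    ring
  have hmid : ∀ i, midAnswer P q D' H' i = midAnswer P q D H i + (q.query i D' - q.query i D) +
      restrictTo R (fun i => a + q.query i D - q.query i D') i := fun i => by
    simp only [midAnswer, hH', alignNoise, Prod.map_snd, Pi.add_apply]
    ring
  -- In a branch whose noise is shifted, the answer and the threshold both move by `a`. In any other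
  -- branch their difference changes by `-(a + qᵢ D - qᵢ D') ≤ 0`, so a failed test still fails.
  have hans : ∀ i, Reached P ε θ k T q D H i →
      answer P ε θ k T q D' H' i = answer P ε θ k T q D H i := fun i hi => by
    have hpat := h i
    rw [adaptiveSVT_of_reached hi] at hpat
    have hvi := hv i hi.1
    have ht := htop i
    have hm := hmid i
    unfold answer at hpat ⊢
    rw [hthr]
    by_cases c1 : topAnswer P q D H i - noisyThreshold P T H ≥ 2 * P.σ
    · rw [if_pos c1] at hpat
      rw [restrictTo, if_pos (hpat.1.mpr ⟨_, rfl⟩)] at ht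
      have e : topAnswer P q D' H' i - (noisyThreshold P T H + a) =
          topAnswer P q D H i - noisyThreshold P T H := by rw [ht]; ring
      rw [e, if_pos c1, if_pos c1]
    -- The reported budget reveals the branch: a middle answer reports `eps1 ≠ eps2`, so the top
    -- noise is not shifted here.
    · have hnS : i ∉ S := fun hiS => by
        rw [if_neg c1] at hpat
        obtain ⟨g, hg⟩ := hpat.1.mp hiS
        split_ifs at hg
        exact h₂ (by simpa using (Slot.top.inj hg).2.symm)
      rw [restrictTo, if_neg hnS] at ht
      have c1' : ¬ topAnswer P q D' H' i - (noisyThreshold P T H + a) ≥ 2 * P.σ := by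
        rw [ht]
        linarith
      rw [if_neg c1] at hpat
      rw [if_neg c1, if_neg c1']
      by_cases c2 : midAnswer P q D H i - noisyThreshold P T H ≥ 0
      · rw [if_pos c2] at hpat
        rw [restrictTo, if_pos (hpat.2.mpr ⟨_, rfl⟩)] at hm
        have e : midAnswer P q D' H' i - (noisyThreshold P T H + a) =
            midAnswer P q D H i - noisyThreshold P T H := by rw [hm]; ring
        rw [e, if_pos c2]
      · rw [if_neg c2] at hpat
        have hnR : i ∉ R := fun hiR => by
          obtain ⟨g, hg⟩ := hpat.2.mp hiR
          cases hg
        rw [restrictTo, if_neg hnR] at hm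
        have c2' : ¬ midAnswer P q D' H' i - (noisyThreshold P T H + a) ≥ 0 := by
          rw [hm]
          linarith
        rw [if_neg c2, if_neg c2']
  have hcost : ∀ n, (∀ i < n, Reached P ε θ k T q D H i) →
      cost P ε θ k T q D' H' n = cost P ε θ k T q D H n := fun n => by
    induction n with
    | zero => exact fun _ => rfl
    | succ n ih =>
      intro hr
      rw [cost, cost, ih fun i hi => hr i (hi.trans n.lt_succ_self), hans n (hr n n.lt_succ_self)]
  have hreach : ∀ i, Reached P ε θ k T q D' H' i ↔ Reached P ε θ k T q D H i := fun i => by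
    induction i with
    | zero => simp [Reached]
    | succ i ih =>
      -- The costs of the two runs are known to agree only while the queries are reached; past a
      -- stop, neither run reaches the next query.
      by_cases hi : Reached P ε θ k T q D H i
      · have hc := hcost (i + 1) fun j hj => hi.of_le (Nat.lt_succ_iff.mp hj)
        refine and_congr_right fun _ => ?_
        rw [Nat.forall_lt_succ_right, Nat.forall_lt_succ_right, hc]
        exact and_congr_left fun _ => iff_of_true (ih.mpr hi).2 hi.2
      · exact iff_of_false (fun hr => hi (ih.mp (hr.of_le i.le_succ)))
          fun hr => hi (hr.of_le i.le_succ)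
  funext i
  by_cases hi : Reached P ε θ k T q D H i
  · rw [adaptiveSVT_of_reached hi, adaptiveSVT_of_reached ((hreach i).mpr hi), hans i hi]
  · rw [adaptiveSVT_of_not_reached hi, adaptiveSVT_of_not_reached fun hr => hi ((hreach i).mp hr)]

/-- By independence the translated law is a product of translated laws, so the factors of the
shifted coordinates multiply and their exponents add up. -/
theorem map_alignNoise_le [IsProbabilityMeasure P.thresholdLaw] [IsProbabilityMeasure P.topLaw]
    [IsProbabilityMeasure P.midLaw] {a c₀ c₁ c₂ : ℝ} {v : ℕ → ℝ} {S R : Finset ℕ}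
    (h0 : P.thresholdLaw.map (· + a) ≤ ENNReal.ofReal (Real.exp c₀) • P.thresholdLaw)
    (h2 : ∀ i ∈ S, P.topLaw.map (· + v i) ≤ ENNReal.ofReal (Real.exp c₂) • P.topLaw)
    (h1 : ∀ i ∈ R, P.midLaw.map (· + v i) ≤ ENNReal.ofReal (Real.exp c₁) • P.midLaw) :
    (noiseLaw P).map (alignNoise a v S R) ≤
      ENNReal.ofReal (Real.exp (c₀ + (S.card * c₂ + R.card * c₁))) • noiseLaw P := by
  have hS := map_add_infinitePi_le P.topLaw (ENNReal.ofReal (Real.exp c₂)) S (restrictTo S v)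
    (fun i hi => by simpa [restrictTo, hi] using h2 i hi) fun i hi => by simp [restrictTo, hi]
  have hR := map_add_infinitePi_le P.midLaw (ENNReal.ofReal (Real.exp c₁)) R (restrictTo R v)
    (fun i hi => by simpa [restrictTo, hi] using h1 i hi) fun i hi => by simp [restrictTo, hi]
  have hm : ∀ w : ℕ → ℝ, Measurable fun x : ℕ → ℝ => x + w := fun w => measurable_add_const w
  have hp : IsProbabilityMeasure ((Measure.infinitePi fun _ : ℕ => P.midLaw).map
      (· + restrictTo R v)) := Measure.isProbabilityMeasure_map (hm _).aemeasurable
  have hp' : IsProbabilityMeasure ((Measure.infinitePi fun _ : ℕ => P.topLaw).map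
      (· + restrictTo S v)) := Measure.isProbabilityMeasure_map (hm _).aemeasurable
  have hexp : ENNReal.ofReal (Real.exp (c₀ + (S.card * c₂ + R.card * c₁))) =
      ENNReal.ofReal (Real.exp c₀) * (ENNReal.ofReal (Real.exp c₂) ^ S.card *
        ENNReal.ofReal (Real.exp c₁) ^ R.card) := by
    rw [Real.exp_add, Real.exp_add, Real.exp_nat_mul, Real.exp_nat_mul,
      ENNReal.ofReal_mul (by positivity), ENNReal.ofReal_mul (by positivity),
      ENNReal.ofReal_pow (by positivity), ENNReal.ofReal_pow (by positivity)]
  unfold noiseLaw alignNoise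
  rw [← Measure.map_prod_map _ _ (measurable_add_const a) ((hm _).prodMap (hm _)),
    ← Measure.map_prod_map _ _ (hm _) (hm _), hexp]
  refine (Measure.prod_mono h0 (Measure.prod_mono hS hR)).trans_eq ?_
  simp only [Measure.prod_smul_left, Measure.prod_smul_right, smul_smul]
  congr 1
  ring

/-- Privacy for two databases, given translations of the noises that align the outputs. -/
theorem measure_adaptiveSVT_le [IsProbabilityMeasure P.thresholdLaw]
    [IsProbabilityMeasure P.topLaw] [IsProbabilityMeasure P.midLaw]
    (hε : 0 < ε) (hθ₁ : θ < 1) (hk : 1 ≤ k) {D' : 𝒟} {a : ℝ}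
    (h0 : P.thresholdLaw.map (· + a) ≤ ENNReal.ofReal (Real.exp (eps0 ε θ)) • P.thresholdLaw)
    (hv : ∀ i : ℕ, (i : ℕ∞) < q.len → 0 ≤ a + q.query i D - q.query i D')
    (h2 : ∀ i : ℕ, (i : ℕ∞) < q.len → P.topLaw.map (· + (a + q.query i D - q.query i D')) ≤
      ENNReal.ofReal (Real.exp (eps2 ε θ k)) • P.topLaw)
    (h1 : ∀ i : ℕ, (i : ℕ∞) < q.len → P.midLaw.map (· + (a + q.query i D - q.query i D')) ≤
      ENNReal.ofReal (Real.exp (eps1 ε θ k)) • P.midLaw)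
    {E : Set Output} (hE : MeasurableSet E) :
    noiseLaw P {H | adaptiveSVT P ε θ k T q D H ∈ E} ≤
      ENNReal.ofReal (Real.exp ε) * noiseLaw P {H | adaptiveSVT P ε θ k T q D' H ∈ E} := by
  set v : ℕ → ℝ := fun i => a + q.query i D - q.query i D' with hvdef
  -- The events are split by pattern because the alignment is a single translation on each piece
  -- only; the index set is countable.
  set A : Finset ℕ × Finset ℕ → Set Noise := fun p =>
    {H | adaptiveSVT P ε θ k T q D H ∈ E ∩ {ω | HasPattern ε θ k p.1 p.2 ω}}
  set B : Finset ℕ × Finset ℕ → Set Noise := fun p =>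
    {H | adaptiveSVT P ε θ k T q D' H ∈ E ∩ {ω | HasPattern ε θ k p.1 p.2 ω}} with hB
  have hBm : ∀ p, MeasurableSet (B p) := fun p =>
    measurable_adaptiveSVT P ε θ k T q D' (hE.inter (measurableSet_hasPattern p.1 p.2))
  have hBd : Pairwise (Function.onFun Disjoint B) := fun p p' hpp =>
    Set.disjoint_left.mpr fun H hH hH' => hpp (hH.2.unique hH'.2)
  have key : ∀ p, noiseLaw P (A p) ≤ ENNReal.ofReal (Real.exp ε) * noiseLaw P (B p) := by
    rintro ⟨S, R⟩
    -- A run realizing the pattern certifies that its positions lie in the list and that its budget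
    -- is at most `ε`.
    rcases (A (S, R)).eq_empty_or_nonempty with hA | ⟨H₀, hH₀⟩
    · simp [hA]
    have hpat := hH₀.2
    have hlen : ∀ i, adaptiveSVT P ε θ k T q D H₀ i ≠ Slot.halted → (i : ℕ∞) < q.len :=
      fun i hi => by
        by_contra hc
        exact hi (adaptiveSVT_of_not_reached fun hr => hc hr.1)
    have hmap : (noiseLaw P).map (alignNoise a v S R) ≤ _ :=
      map_alignNoise_le h0
        (fun i hi => h2 i (hlen i (by obtain ⟨g, hg⟩ := (hpat i).1.mp hi; simp [hg])))
        (fun i hi => h1 i (hlen i (by obtain ⟨g, hg⟩ := (hpat i).2.mp hi; simp [hg])))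
    have halign : Measurable (alignNoise a v S R) :=
      (measurable_add_const a).prodMap
        ((measurable_add_const (restrictTo S v)).prodMap (measurable_add_const (restrictTo R v)))
    calc noiseLaw P (A (S, R)) ≤ noiseLaw P (alignNoise a v S R ⁻¹' B (S, R)) := by
          refine measure_mono fun H hH => ?_
          simp only [hB, Set.mem_preimage, Set.mem_ofPred_eq]
          rw [adaptiveSVT_alignNoise (eps1_pos hε hθ₁ hk) hH.2 hv]
          exact hH
      _ = (noiseLaw P).map (alignNoise a v S R) (B (S, R)) :=
          (Measure.map_apply halign (hBm _)).symm
      _ ≤ _ := hmap _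
      _ ≤ ENNReal.ofReal (Real.exp ε) * noiseLaw P (B (S, R)) := by
          rw [Measure.smul_apply, smul_eq_mul]
          gcongr
          exact hpat.budget_le hε hθ₁ hk
  calc noiseLaw P {H | adaptiveSVT P ε θ k T q D H ∈ E} ≤ noiseLaw P (⋃ p, A p) := by
        refine measure_mono fun H hH => ?_
        obtain ⟨S, R, hSR⟩ := exists_hasPattern (P := P) (T := T) (q := q) (D := D) (H := H)
          hε hθ₁ hk
        exact Set.mem_iUnion.mpr ⟨(S, R), hH, hSR⟩
    _ ≤ ∑' p, noiseLaw P (A p) := measure_iUnion_le A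
    _ ≤ ∑' p, ENNReal.ofReal (Real.exp ε) * noiseLaw P (B p) := ENNReal.tsum_le_tsum key
    _ = ENNReal.ofReal (Real.exp ε) * noiseLaw P (⋃ p, B p) := by
        rw [ENNReal.tsum_mul_left, measure_iUnion hBd hBm]
    _ ≤ _ := by
        gcongr
        exact Set.iUnion_subset fun p H hH => hH.1

end Algorithm


/-! ### Privacy for the choices of the noise -/

variable {𝒟 : Type*} {Adj : 𝒟 → 𝒟 → Prop} {q : QueryList 𝒟}

theorem QueryList.SensitivityOne.abs_sub_le (hq : q.SensitivityOne Adj) {D D' : 𝒟}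
    (hD : Adj D D') {i : ℕ} (hi : (i : ℕ∞) < q.len) : |q.query i D - q.query i D'| ≤ 1 := by
  have h : ENNReal.ofReal |q.query i D - q.query i D'| ≤ 1 :=
    le_trans (le_iSup_of_le D (le_iSup_of_le D'
      (le_iSup (fun _ : Adj D D' => ENNReal.ofReal |q.query i D - q.query i D'|) hD))) (hq i hi)
  simpa using h

theorem QueryList.IntegerValued.exists_int_eq (hint : q.IntegerValued) (D D' : 𝒟) {a : ℝ}
    (ha : ∃ z : ℤ, a = z) {i : ℕ} (hi : (i : ℕ∞) < q.len) :
    ∃ z : ℤ, a + q.query i D - q.query i D' = z := by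
  obtain ⟨z, hz⟩ := ha
  obtain ⟨x, hx⟩ := hint i hi D
  obtain ⟨y, hy⟩ := hint i hi D'
  exact ⟨z + x - y, by rw [hz, hx, hy]; push_cast; ring⟩

/-- Privacy of Adaptive SVT, if translating the threshold noise by `1`, and the query noises by
any `v ∈ [0, 2]` in a set `V` that contains all `1 + qᵢ D - qᵢ D'`, changes their laws by at most
the budget of the answer. -/
theorem isPrivate_of_map_add_le (hq : q.SensitivityOne Adj) {P : NoiseParams} {ε θ T : ℝ} {k : ℕ}
    [IsProbabilityMeasure P.thresholdLaw] [IsProbabilityMeasure P.topLaw]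
    [IsProbabilityMeasure P.midLaw] (hε : 0 < ε) (hθ₁ : θ < 1) (hk : 1 ≤ k) (V : Set ℝ)
    (hV : ∀ i : ℕ, (i : ℕ∞) < q.len → ∀ D D', 1 + q.query i D - q.query i D' ∈ V)
    (h0 : P.thresholdLaw.map (· + 1) ≤ ENNReal.ofReal (Real.exp (eps0 ε θ)) • P.thresholdLaw)
    (h2 : ∀ v ∈ V, 0 ≤ v → v ≤ 2 →
      P.topLaw.map (· + v) ≤ ENNReal.ofReal (Real.exp (eps2 ε θ k)) • P.topLaw)
    (h1 : ∀ v ∈ V, 0 ≤ v → v ≤ 2 →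
      P.midLaw.map (· + v) ≤ ENNReal.ofReal (Real.exp (eps1 ε θ k)) • P.midLaw) :
    IsPrivate P ε θ k T q Adj := by
  intro D D' hD E hE
  have hs := fun (i : ℕ) (hi : (i : ℕ∞) < q.len) => abs_le.mp (hq.abs_sub_le hD hi)
  -- As `qᵢ D - qᵢ D' ≥ -1`, the threshold shift `1` makes all query shifts nonnegative in either
  -- direction, at the price of shifts up to `2`.
  exact measure_adaptiveSVT_le hε hθ₁ hk (a := 1) h0 (fun i hi => by linarith [(hs i hi).1])
    (fun i hi => h2 _ (hV i hi D D') (by linarith [(hs i hi).1]) (by linarith [(hs i hi).2]))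
    (fun i hi => h1 _ (hV i hi D D') (by linarith [(hs i hi).1]) (by linarith [(hs i hi).2])) hE

/-- The analogue of `isPrivate_of_map_add_le` for monotonic lists of queries, where translations
by at most `1` suffice. -/
theorem isPrivate_of_map_add_le_of_monotonic (hq : q.SensitivityOne Adj) (hmono : q.Monotonic Adj)
    {P : NoiseParams} {ε θ T : ℝ} {k : ℕ}
    [IsProbabilityMeasure P.thresholdLaw] [IsProbabilityMeasure P.topLaw]
    [IsProbabilityMeasure P.midLaw] (hε : 0 < ε) (hθ₀ : 0 < θ) (hθ₁ : θ < 1) (hk : 1 ≤ k)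
    (V : Set ℝ)
    (hV : ∀ i : ℕ, (i : ℕ∞) < q.len → ∀ D D', q.query i D - q.query i D' ∈ V)
    (hV' : ∀ i : ℕ, (i : ℕ∞) < q.len → ∀ D D', 1 + q.query i D - q.query i D' ∈ V)
    (h0 : P.thresholdLaw.map (· + 1) ≤ ENNReal.ofReal (Real.exp (eps0 ε θ)) • P.thresholdLaw)
    (h2 : ∀ v ∈ V, 0 ≤ v → v ≤ 1 →
      P.topLaw.map (· + v) ≤ ENNReal.ofReal (Real.exp (eps2 ε θ k)) • P.topLaw)
    (h1 : ∀ v ∈ V, 0 ≤ v → v ≤ 1 →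
      P.midLaw.map (· + v) ≤ ENNReal.ofReal (Real.exp (eps1 ε θ k)) • P.midLaw) :
    IsPrivate P ε θ k T q Adj := by
  intro D D' hD E hE
  have hs := fun (i : ℕ) (hi : (i : ℕ∞) < q.len) => abs_le.mp (hq.abs_sub_le hD hi)
  -- If the answers increase from `D` to `D'`, the threshold shift `1` gives query shifts in `[0,
  -- 1]`; if they decrease, the differences are already in `[0, 1]` and the threshold stays.
  rcases hmono D D' hD with hm | hm
  · exact measure_adaptiveSVT_le hε hθ₁ hk (a := 1) h0 (fun i hi => by linarith [(hs i hi).1])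
      (fun i hi => h2 _ (hV' i hi D D') (by linarith [(hs i hi).1]) (by linarith [hm i hi]))
      (fun i hi => h1 _ (hV' i hi D D') (by linarith [(hs i hi).1]) (by linarith [hm i hi])) hE
  · have h00 : P.thresholdLaw.map (· + 0) ≤
        ENNReal.ofReal (Real.exp (eps0 ε θ)) • P.thresholdLaw := by
      simp only [add_zero, Measure.map_id']
      have hone : 1 ≤ ENNReal.ofReal (Real.exp (eps0 ε θ)) :=
        ENNReal.one_le_ofReal.mpr (Real.one_le_exp (mul_nonneg hθ₀.le hε.le))
      intro A
      simpa using le_mul_of_one_le_left (zero_le (a := P.thresholdLaw A)) hone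
    have hz : ∀ i D D', 0 + q.query i D - q.query i D' = q.query i D - q.query i D' :=
      fun i D D' => by rw [zero_add]
    exact measure_adaptiveSVT_le hε hθ₁ hk (a := 0) h00
      (fun i hi => by linarith [hm i hi])
      (fun i hi => by
        rw [hz]
        exact h2 _ (hV i hi D D') (by linarith [hm i hi]) (by linarith [(hs i hi).2]))
      (fun i hi => by
        rw [hz]
        exact h1 _ (hV i hi D D') (by linarith [hm i hi]) (by linarith [(hs i hi).2])) hE

/-! ### Translation bounds for the six noise choices -/

section Laws

variable {ε θ T : ℝ} {k : ℕ}

theorem isPrivate_laplace (hq : q.SensitivityOne Adj) (hε : 0 < ε) (hθ₀ : 0 < θ) (hθ₁ : θ < 1)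
    (hk : 1 ≤ k) : IsPrivate (laplace ε θ k) ε θ k T q Adj := by
  have e0 : 0 < eps0 ε θ := mul_pos hθ₀ hε
  have e1 := eps1_pos hε hθ₁ hk
  have e2 := eps2_pos hε hθ₁ hk
  have : IsProbabilityMeasure (laplace ε θ k).thresholdLaw :=
    isProbabilityMeasure_lapNoise (by positivity)
  have : IsProbabilityMeasure (laplace ε θ k).topLaw :=
    isProbabilityMeasure_lapNoise (by positivity)
  have : IsProbabilityMeasure (laplace ε θ k).midLaw :=
    isProbabilityMeasure_lapNoise (by positivity)
  refine isPrivate_of_map_add_le hq hε hθ₁ hk Set.univ (fun _ _ _ _ => Set.mem_univ _) ?_ ?_ ?_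
  · refine map_add_lapNoise_le (by positivity) ?_
    rw [mul_div_cancel₀ _ e0.ne', abs_one]
  · intro v _ hv hv'
    refine map_add_lapNoise_le (by positivity) ?_
    rwa [mul_div_cancel₀ _ e2.ne', abs_of_nonneg hv]
  · intro v _ hv hv'
    refine map_add_lapNoise_le (by positivity) ?_
    rwa [mul_div_cancel₀ _ e1.ne', abs_of_nonneg hv]

theorem isPrivate_exponential (hq : q.SensitivityOne Adj) (hε : 0 < ε) (hθ₀ : 0 < θ)
    (hθ₁ : θ < 1) (hk : 1 ≤ k) : IsPrivate (exponential ε θ k) ε θ k T q Adj := by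
  have e0 : 0 < eps0 ε θ := mul_pos hθ₀ hε
  have e1 := eps1_pos hε hθ₁ hk
  have e2 := eps2_pos hε hθ₁ hk
  have : IsProbabilityMeasure (exponential ε θ k).thresholdLaw :=
    isProbabilityMeasure_expNoise (by positivity)
  have : IsProbabilityMeasure (exponential ε θ k).topLaw :=
    isProbabilityMeasure_expNoise (by positivity)
  have : IsProbabilityMeasure (exponential ε θ k).midLaw :=
    isProbabilityMeasure_expNoise (by positivity)
  refine isPrivate_of_map_add_le hq hε hθ₁ hk Set.univ (fun _ _ _ _ => Set.mem_univ _) ?_ ?_ ?_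
  · refine map_add_expNoise_le (by positivity) zero_le_one ?_
    rw [mul_div_cancel₀ _ e0.ne']
  · intro v _ hv hv'
    refine map_add_expNoise_le (by positivity) hv ?_
    rwa [mul_div_cancel₀ _ e2.ne']
  · intro v _ hv hv'
    refine map_add_expNoise_le (by positivity) hv ?_
    rwa [mul_div_cancel₀ _ e1.ne']

theorem isPrivate_geometric (hq : q.SensitivityOne Adj) (hint : q.IntegerValued) (hε : 0 < ε)
    (hθ₀ : 0 < θ) (hθ₁ : θ < 1) (hk : 1 ≤ k) :
    IsPrivate (geometric ε θ k) ε θ k T q Adj := by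
  have e0 : 0 < eps0 ε θ := mul_pos hθ₀ hε
  have e1 := eps1_pos hε hθ₁ hk
  have e2 := eps2_pos hε hθ₁ hk
  have : IsProbabilityMeasure (geometric ε θ k).thresholdLaw := isProbabilityMeasure_geoNoise _
  have : IsProbabilityMeasure (geometric ε θ k).topLaw := isProbabilityMeasure_geoNoise _
  have : IsProbabilityMeasure (geometric ε θ k).midLaw := isProbabilityMeasure_geoNoise _
  refine isPrivate_of_map_add_le hq hε hθ₁ hk {v | ∃ z : ℤ, v = z}
    (fun i hi D D' => hint.exists_int_eq D D' ⟨1, by simp⟩ hi) ?_ ?_ ?_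
  · exact map_add_geoNoise_le e0 ⟨1, by simp⟩ zero_le_one (one_mul _).le
  · intro v hz hv hv'
    -- This exposes the form `1 - exp (-b)` with `b = eps2 / 2`, so that `v ≤ 2` gives `v * b ≤
    -- eps2`.
    simp only [geometric, neg_div]
    exact map_add_geoNoise_le (half_pos e2) hz hv (by nlinarith)
  · intro v hz hv hv'
    simp only [geometric, neg_div]
    exact map_add_geoNoise_le (half_pos e1) hz hv (by nlinarith)

theorem isPrivate_laplaceReduced (hq : q.SensitivityOne Adj) (hmono : q.Monotonic Adj)
    (hε : 0 < ε) (hθ₀ : 0 < θ) (hθ₁ : θ < 1) (hk : 1 ≤ k) (σ : ℝ) :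
    IsPrivate (laplaceReduced ε θ k σ) ε θ k T q Adj := by
  have e0 : 0 < eps0 ε θ := mul_pos hθ₀ hε
  have e1 := eps1_pos hε hθ₁ hk
  have e2 := eps2_pos hε hθ₁ hk
  have : IsProbabilityMeasure (laplaceReduced ε θ k σ).thresholdLaw :=
    isProbabilityMeasure_lapNoise (by positivity)
  have : IsProbabilityMeasure (laplaceReduced ε θ k σ).topLaw :=
    isProbabilityMeasure_lapNoise (by positivity)
  have : IsProbabilityMeasure (laplaceReduced ε θ k σ).midLaw :=
    isProbabilityMeasure_lapNoise (by positivity)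
  refine isPrivate_of_map_add_le_of_monotonic hq hmono hε hθ₀ hθ₁ hk Set.univ
    (fun _ _ _ _ => Set.mem_univ _) (fun _ _ _ _ => Set.mem_univ _) ?_ ?_ ?_
  · refine map_add_lapNoise_le (by positivity) ?_
    rw [mul_div_cancel₀ _ e0.ne', abs_one]
  · intro v _ hv hv'
    refine map_add_lapNoise_le (by positivity) ?_
    rwa [mul_div_cancel₀ _ e2.ne', abs_of_nonneg hv]
  · intro v _ hv hv'
    refine map_add_lapNoise_le (by positivity) ?_
    rwa [mul_div_cancel₀ _ e1.ne', abs_of_nonneg hv]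

theorem isPrivate_exponentialReduced (hq : q.SensitivityOne Adj) (hmono : q.Monotonic Adj)
    (hε : 0 < ε) (hθ₀ : 0 < θ) (hθ₁ : θ < 1) (hk : 1 ≤ k) :
    IsPrivate (exponentialReduced ε θ k) ε θ k T q Adj := by
  have e0 : 0 < eps0 ε θ := mul_pos hθ₀ hε
  have e1 := eps1_pos hε hθ₁ hk
  have e2 := eps2_pos hε hθ₁ hk
  have : IsProbabilityMeasure (exponentialReduced ε θ k).thresholdLaw :=
    isProbabilityMeasure_expNoise (by positivity)
  have : IsProbabilityMeasure (exponentialReduced ε θ k).topLaw :=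
    isProbabilityMeasure_expNoise (by positivity)
  have : IsProbabilityMeasure (exponentialReduced ε θ k).midLaw :=
    isProbabilityMeasure_expNoise (by positivity)
  refine isPrivate_of_map_add_le_of_monotonic hq hmono hε hθ₀ hθ₁ hk Set.univ
    (fun _ _ _ _ => Set.mem_univ _) (fun _ _ _ _ => Set.mem_univ _) ?_ ?_ ?_
  · refine map_add_expNoise_le (by positivity) zero_le_one ?_
    rw [mul_div_cancel₀ _ e0.ne']
  · intro v _ hv hv'
    refine map_add_expNoise_le (by positivity) hv ?_
    rwa [mul_div_cancel₀ _ e2.ne']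
  · intro v _ hv hv'
    refine map_add_expNoise_le (by positivity) hv ?_
    rwa [mul_div_cancel₀ _ e1.ne']

theorem isPrivate_geometricReduced (hq : q.SensitivityOne Adj) (hmono : q.Monotonic Adj)
    (hint : q.IntegerValued) (hε : 0 < ε) (hθ₀ : 0 < θ) (hθ₁ : θ < 1) (hk : 1 ≤ k) :
    IsPrivate (geometricReduced ε θ k) ε θ k T q Adj := by
  have e0 : 0 < eps0 ε θ := mul_pos hθ₀ hε
  have e1 := eps1_pos hε hθ₁ hk
  have e2 := eps2_pos hε hθ₁ hk
  have : IsProbabilityMeasure (geometricReduced ε θ k).thresholdLaw :=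
    isProbabilityMeasure_geoNoise _
  have : IsProbabilityMeasure (geometricReduced ε θ k).topLaw := isProbabilityMeasure_geoNoise _
  have : IsProbabilityMeasure (geometricReduced ε θ k).midLaw := isProbabilityMeasure_geoNoise _
  refine isPrivate_of_map_add_le_of_monotonic hq hmono hε hθ₀ hθ₁ hk {v | ∃ z : ℤ, v = z}
    (fun i hi D D' => by simpa using hint.exists_int_eq D D' (a := 0) ⟨0, by simp⟩ hi)
    (fun i hi D D' => hint.exists_int_eq D D' ⟨1, by simp⟩ hi) ?_ ?_ ?_
  · exact map_add_geoNoise_le e0 ⟨1, by simp⟩ zero_le_one (one_mul _).le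
  · intro v hz hv hv'
    exact map_add_geoNoise_le e2 hz hv (by nlinarith)
  · intro v hz hv hv'
    exact map_add_geoNoise_le e1 hz hv (by nlinarith)

end Laws

end AdaptiveSVT

theorem mainTheorem2 {𝒟 : Type*} (Adj : 𝒟 → 𝒟 → Prop) (q : AdaptiveSVT.QueryList 𝒟)
    (hq : q.SensitivityOne Adj) (ε θ T : ℝ) (k : ℕ) (hε : 0 < ε) (hθ₀ : 0 < θ) (hθ₁ : θ < 1)
    (hk : 1 ≤ k) :
    AdaptiveSVT.IsPrivate (AdaptiveSVT.laplace ε θ k) ε θ k T q Adj ∧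
    AdaptiveSVT.IsPrivate (AdaptiveSVT.exponential ε θ k) ε θ k T q Adj ∧
    (q.IntegerValued →
      AdaptiveSVT.IsPrivate (AdaptiveSVT.geometric ε θ k) ε θ k T q Adj) ∧
    (q.Monotonic Adj →
      (∀ σ : ℝ, AdaptiveSVT.IsPrivate (AdaptiveSVT.laplaceReduced ε θ k σ) ε θ k T q Adj) ∧
      AdaptiveSVT.IsPrivate (AdaptiveSVT.exponentialReduced ε θ k) ε θ k T q Adj ∧
      (q.IntegerValued →
        AdaptiveSVT.IsPrivate (AdaptiveSVT.geometricReduced ε θ k) ε θ k T q Adj)) := by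
  open AdaptiveSVT in
  exact ⟨isPrivate_laplace hq hε hθ₀ hθ₁ hk, isPrivate_exponential hq hε hθ₀ hθ₁ hk,
    fun hint => isPrivate_geometric hq hint hε hθ₀ hθ₁ hk,
    fun hmono => ⟨fun σ => isPrivate_laplaceReduced hq hmono hε hθ₀ hθ₁ hk σ,
      isPrivate_exponentialReduced hq hmono hε hθ₀ hθ₁ hk,
      fun hint => isPrivate_geometricReduced hq hmono hint hε hθ₀ hθ₁ hk⟩⟩
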